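/- Let $f,g^{(1)},\dots,g^{(m)}:\mathbb R^n\to\mathbb R$, $A\in\mathbb R^{p\times n}$, $b\in\mathbb R^p$ and let $X\subseteq\mathbb R^n$ be closed and convex. Consider the problem of minimizing $f(x)$ subject to $g^{(i)}(x)\le 0$ ($i=1,\dots,m$), $Ax+b=0$, $x\in X$, with optimal value $f^\star$. Norms are Euclidean unless marked $\|\cdot\|_\infty$. For $h:\mathbb R^n\to\mathbb R$, $\partial h(x)$ denotes the set of $s$ with $h(y)\ge h(x)+s^T(y-x)-o(\|y-x\|)$ as $y\to x$; this is the usual subdifferential if $h$ is convex on $\mathbb R^n$, and $\{\nabla h(x)\}$ if $h$ is differentiable at $x$. Assume: (a) $\theta>0$ and $f(y)-f(x)-s^T(y-x)\ge\frac{\theta}{2}\|x-y\|^2$ for all $x,y\in X$, $s\in\partial f(x)$; (b) each $g^{(i)}$ is convex on $X$ and $|g^{(i)}(x)-g^{(i)}(y)|\le L_i\|x-y\|$ for all $x,y\in X$, where $L_i>0$; moreover $\partial f(x)$ and $\partial g^{(i)}(x)$ are nonempty for all $x\in X$ (automatic for functions convex on $\mathbb R^n$); (c) there is $\tilde x$ in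 the relative interior of $X$ with $g^{(i)}(\tilde x)<0$ for all $i$ and $A\tilde x+b=0$; (d) $m+p\ne0$, and $A\neq0$ if $p\ne0$. Let $D=\{u\in\mathbb R^{m+p}:u^{(1)},\dots,u^{(m)}\ge0\}$, let $\mathcal L(x,u)=f(x)+\sum_{i=1}^m u^{(i)}g^{(i)}(x)+(u^{(m+1:m+p)})^T(Ax+b)$ and $d(u)=\min_{x\in X}\mathcal L(x,u)$, let $\bar x(u)$ be the minimizer of $\mathcal L(\cdot,u)$ over $X$, $d^\star=\sup_{u\in D} d(u)$, and let $D^\star$ be the set of maximizers of $d$ over $D$. Let $\nabla d(u)$, $u\in D$, be the gradient of $d$ relative to $D$. Put $G(u)=\bigcup_{i=1}^m\partial g^{(i)}(\bar x(u))$ and assume that (e) $\bigcup_{u\in D}G(u)$ is bounded. With $\sigma_{\max}(A)$ the largest singular value of $A$ ($0$ if $n=0$ or $p=0$) and $\sup\emptyset=0$, let $$\gamma(u)=\frac{\sqrt{m+1}}{\theta}\max\Bigl\{\sigma_{\max}(A),\sup_{q\in G(u)}\|q\|\Bigr\},\qquad \tilde L=\sup_{u\in D}\gamma(u)\Bigl(\sigma_{\max}^2(A)+\sum_{i=1}^mL_i^2\Bigr)^{1/2},$$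 $$\Delta(x)=\Bigl(\|Ax+b\|^2+\sum_{i=1}^m\max\{0,g^{(i)}(x)\}^2\Bigr)^{1/2}.$$ Let $h:\mathbb R^{m+p}\to\mathbb R$ be differentiable on an open set containing $D$ and strictly convex on $D$, let $Q(u,v)=h(u)-h(v)-\nabla h(v)^T(u-v)$, and assume $Q(u,v)\ge\frac12\|u-v\|^2$ for all $u,v\in D$. Put $\ell_{-d}(u,v)=-d(v)-\nabla d(v)^T(u-v)$. Let $(u_k)_{k\ge0}\subset D$ be generated by the $1$-memory fast gradient method: $\beta_0=1$, $u_0,w_0\in D$, and for each $k\ge0$, 1. $U_k\subseteq\mathbb R^{m+p}$ is a closed convex set with $U_k\cap D^\star\ne\emptyset$; 2. $v_k=(1-\beta_k)u_k+\beta_kw_k$, $\;w_{k+1}\in\arg\min_{u\in U_k\cap D}\{\ell_{-d}(u,v_k)+\beta_k\tilde L\,Q(u,w_k)\}$, $\;\hat u_{k+1}=(1-\beta_k)u_k+\beta_kw_{k+1}$; 3. $u_{k+1}\in D$ satisfies $\ell_{-d}(u_{k+1},v_k)+\frac{\tilde L}{2}\|u_{k+1}-v_k\|^2\le\ell_{-d}(\hat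 u_{k+1},v_k)+\frac{\tilde L}{2}\|\hat u_{k+1}-v_k\|^2$; 4. $0<\beta_{k+1}\le\frac{2}{k+3}$ and $\frac{1-\beta_{k+1}}{\beta_{k+1}^2}\le\frac1{\beta_k^2}$ (for example $\beta_{k+1}=\frac{2}{k+3}$ for all $k$). Let $u^\star\in D^\star$ be such that $u^\star\in U_k$ for all $k$ (no restriction if $U_k\supseteq D$ for all $k$). Then for every $u\in D$ the minimizer $\bar x(u)$ exists and is unique and $d$ is differentiable at $u$ relative to $D$; $\sup_{u\in D}\gamma(u)<\infty$; the problem has a unique optimal solution $x^\star$; and for every $k\ge1$, $$d^\star-d(u_k)\le\frac{4\tilde L\,Q(u^\star,w_0)}{(k+1)^2},\qquad \|\bar x(u_k)-x^\star\|\le\frac{\bigl(8\tilde L\,Q(u^\star,w_0)\,\theta^{-1}\bigr)^{1/2}}{k+1},$$ $$f(\bar x(u_k))-f^\star\le\frac{\tilde L\|u_k\|_\infty\bigl(8(m+p)Q(u^\star,w_0)\bigr)^{1/2}}{k+1}+\frac{4\tilde L\,Q(u^\star,w_0)}{(k+1)^2},$$ $$f(\bar x(u_k))-f^\star\ge-\frac{\tilde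 L\|u^\star\|\bigl(8Q(u^\star,w_0)\bigr)^{1/2}}{k+1},\qquad \Delta(\bar x(u_k))\le\frac{\tilde L\bigl(8Q(u^\star,w_0)\bigr)^{1/2}}{k+1}.$$ -/

import Mathlib

open Filter Topology

noncomputable section

/-- The subdifferential of `h : ℝⁿ → ℝ` at `x`, described locally: `s` belongs to it when
`h y ≥ h x + ⟨s, y - x⟩ - o(‖y - x‖)` as `y → x`. For a convex `h` this is the usual
subdifferential of convex analysis (`mem_subdifferential_iff_of_convexOn`), and at a point of
differentiability of any `h` it is `{∇ h x}` (`subdifferential_eq_of_hasGradientAt`). The local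
form is used because the functions below are convex only on a subset of `ℝⁿ`. -/
def subdifferential {n : ℕ} (h : EuclideanSpace ℝ (Fin n) → ℝ) (x : EuclideanSpace ℝ (Fin n)) :
    Set (EuclideanSpace ℝ (Fin n)) :=
  {s | ∀ ε : ℝ, 0 < ε → ∀ᶠ y in 𝓝 x, h x + inner ℝ s (y - x) - ε * ‖y - x‖ ≤ h y}

/-- A subgradient of a function that is convex on a set `X` satisfies the subgradient inequality
on `X`. -/
theorem subgradient_inequality_of_convexOn {n : ℕ} {h : EuclideanSpace ℝ (Fin n) → ℝ}
    {X : Set (EuclideanSpace ℝ (Fin n))} (hh : ConvexOn ℝ X h)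
    {x y s : EuclideanSpace ℝ (Fin n)} (hx : x ∈ X) (hy : y ∈ X)
    (hs : s ∈ subdifferential h x) : h x + inner ℝ s (y - x) ≤ h y := by
  refine le_of_forall_pos_le_add fun ε hε => ?_
  have hN : (0 : ℝ) < ‖y - x‖ + 1 := by positivity
  have hev := hs (ε / (‖y - x‖ + 1)) (div_pos hε hN)
  have hlim : Tendsto (fun t : ℝ => x + t • (y - x)) (𝓝[>] 0) (𝓝 x) := by
    have hc : Continuous (fun t : ℝ => x + t • (y - x)) := by fun_prop
    have := (hc.tendsto 0).mono_left (nhdsWithin_le_nhds (s := Set.Ioi (0 : ℝ)))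
    simpa using this
  have h1 : ∀ᶠ t : ℝ in 𝓝[>] 0, t ≤ 1 := by
    filter_upwards [Ioo_mem_nhdsGT (zero_lt_one' ℝ)] with t ht using ht.2.le
  obtain ⟨t, ⟨ht, ht1⟩, ht0⟩ :=
    (((hlim.eventually hev).and h1).and self_mem_nhdsWithin).exists
  have ht0 : (0 : ℝ) < t := ht0
  have hconv := hh.2 hx hy (sub_nonneg.2 ht1) ht0.le (by ring)
  have hpt : (1 - t) • x + t • y = x + t • (y - x) := by
    rw [smul_sub, sub_smul, one_smul]; abel
  rw [hpt] at hconv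
  simp only [add_sub_cancel_left, inner_smul_right, norm_smul, Real.norm_eq_abs, abs_of_pos ht0,
    smul_eq_mul] at ht hconv
  have hle : ε / (‖y - x‖ + 1) * ‖y - x‖ ≤ ε := by
    rw [div_mul_eq_mul_div, div_le_iff₀ hN]; nlinarith [norm_nonneg (y - x)]
  have : t * (h x + inner ℝ s (y - x) - ε / (‖y - x‖ + 1) * ‖y - x‖) ≤ t * h y := by
    nlinarith
  have := le_of_mul_le_mul_left this ht0
  linarith

/-- For a convex function the local subdifferential is the usual one. -/
theorem mem_subdifferential_iff_of_convexOn {n : ℕ} {h : EuclideanSpace ℝ (Fin n) → ℝ}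
    (hh : ConvexOn ℝ Set.univ h) (x s : EuclideanSpace ℝ (Fin n)) :
    s ∈ subdifferential h x ↔ ∀ y, h x + inner ℝ s (y - x) ≤ h y := by
  refine ⟨fun hs y => subgradient_inequality_of_convexOn hh trivial trivial hs, fun hs ε hε => ?_⟩
  exact Eventually.of_forall fun y => by
    have := hs y
    have : 0 ≤ ε * ‖y - x‖ := by positivity
    linarith [hs y]

/-- At a point of differentiability the subdifferential is the singleton of the gradient. -/
theorem subdifferential_eq_of_hasGradientAt {n : ℕ} {h : EuclideanSpace ℝ (Fin n) → ℝ}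
    {x q : EuclideanSpace ℝ (Fin n)} (hq : HasGradientAt h q x) : subdifferential h x = {q} := by
  have key : ∀ ε : ℝ, 0 < ε →
      ∀ᶠ y in 𝓝 x, |h y - h x - inner ℝ q (y - x)| ≤ ε * ‖y - x‖ := by
    intro ε hε
    have := (hasGradientAt_iff_isLittleO.1 hq).def hε
    simpa [Real.norm_eq_abs] using this
  ext s
  simp only [Set.mem_singleton_iff]
  constructor
  · intro hs
    by_contra hne
    have hpos : 0 < ‖s - q‖ := norm_pos_iff.2 (sub_ne_zero.2 hne)
    have hev := (hs (‖s - q‖ / 4) (by positivity)).and (key (‖s - q‖ / 4) (by positivity))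
    have hlim : Tendsto (fun t : ℝ => x + t • (s - q)) (𝓝[>] 0) (𝓝 x) := by
      have hc : Continuous (fun t : ℝ => x + t • (s - q)) := by fun_prop
      have := (hc.tendsto 0).mono_left (nhdsWithin_le_nhds (s := Set.Ioi (0 : ℝ)))
      simpa using this
    obtain ⟨t, ⟨ht1, ht2⟩, ht0⟩ := ((hlim.eventually hev).and self_mem_nhdsWithin).exists
    have ht0 : (0 : ℝ) < t := ht0
    have ht2 := (abs_le.1 ht2).2
    simp only [add_sub_cancel_left, inner_smul_right, norm_smul, Real.norm_eq_abs,
      abs_of_pos ht0] at ht1 ht2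
    have hin : inner ℝ s (s - q) - inner ℝ q (s - q) = ‖s - q‖ ^ 2 := by
      rw [← inner_sub_left, real_inner_self_eq_norm_sq]
    have h3 : t * ‖s - q‖ ^ 2 ≤ t * ‖s - q‖ ^ 2 / 2 := by
      have e : t * inner ℝ s (s - q) - t * inner ℝ q (s - q) = t * ‖s - q‖ ^ 2 := by
        rw [← mul_sub, hin]
      nlinarith
    nlinarith [mul_pos ht0 (pow_pos hpos 2)]
  · rintro rfl ε hε
    filter_upwards [key ε hε] with y hy
    linarith [(abs_le.1 hy).1]

/-- The data of the problem: minimize `f x` subject to `g i x ≤ 0` for `i = 1, …, m`,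
`A x + b = 0` and `x ∈ X`. -/
structure ConvexProgram (n m p : ℕ) where
  /-- objective -/
  f : EuclideanSpace ℝ (Fin n) → ℝ
  /-- inequality constraint functions -/
  g : Fin m → EuclideanSpace ℝ (Fin n) → ℝ
  /-- matrix of the equality constraint -/
  A : Matrix (Fin p) (Fin n) ℝ
  /-- offset of the equality constraint -/
  b : EuclideanSpace ℝ (Fin p)
  /-- set constraint -/
  X : Set (EuclideanSpace ℝ (Fin n))

/-- The space `ℝ^{m+p}` of dual variables: the first `m` coordinates are `u (Sum.inl i)`, the
last `p` are `u (Sum.inr j)`. -/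
abbrev DualSpace (m p : ℕ) : Type := EuclideanSpace ℝ (Fin m ⊕ Fin p)

namespace ConvexProgram

variable {n m p : ℕ} (P : ConvexProgram n m p)

/-- `A x + b`. -/
def eqResidual (x : EuclideanSpace ℝ (Fin n)) : EuclideanSpace ℝ (Fin p) :=
  Matrix.toEuclideanLin P.A x + P.b

/-- `σ_max(A)`, the largest singular value, i.e. the operator norm of `A` between Euclidean
spaces (it is `0` if `n = 0` or `p = 0`). -/
def sigmaMax : ℝ := ‖(Matrix.toEuclideanLin P.A).toContinuousLinearMap‖

/-- The feasible set of the primal problem. -/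
def feasible : Set (EuclideanSpace ℝ (Fin n)) :=
  {x | x ∈ P.X ∧ (∀ i, P.g i x ≤ 0) ∧ P.eqResidual x = 0}

/-- `f⋆`, the primal optimal value. -/
def primalValue : ℝ := sInf (P.f '' P.feasible)

/-- `x` is an optimal solution of the primal problem. -/
def IsPrimalSolution (x : EuclideanSpace ℝ (Fin n)) : Prop :=
  x ∈ P.feasible ∧ IsMinOn P.f P.feasible x

/-- Standing assumptions on the problem, with convexity parameter `θ` and Lipschitz constants
`L i`. A convex function `ℝⁿ → ℝ` is subdifferentiable everywhere; since `f` and `g i` are convex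
on `X` only, subdifferentiability on `X` is recorded explicitly. -/
structure Regular (θ : ℝ) (L : Fin m → ℝ) : Prop where
  isClosed_X : IsClosed P.X
  convex_X : Convex ℝ P.X
  theta_pos : 0 < θ
  subdifferentiable_f : ∀ x ∈ P.X, (subdifferential P.f x).Nonempty
  strongly_convex_f : ∀ x ∈ P.X, ∀ y ∈ P.X, ∀ s ∈ subdifferential P.f x,
    θ / 2 * ‖x - y‖ ^ 2 ≤ P.f y - P.f x - inner ℝ s (y - x)
  subdifferentiable_g : ∀ i, ∀ x ∈ P.X, (subdifferential (P.g i) x).Nonempty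
  convex_g : ∀ i, ConvexOn ℝ P.X (P.g i)
  L_pos : ∀ i, 0 < L i
  lipschitz_g : ∀ i, ∀ x ∈ P.X, ∀ y ∈ P.X, |P.g i x - P.g i y| ≤ L i * ‖x - y‖
  slater : ∃ x ∈ intrinsicInterior ℝ P.X, (∀ i, P.g i x < 0) ∧ P.eqResidual x = 0
  constraints : m + p ≠ 0
  A_ne_zero : p ≠ 0 → P.A ≠ 0

/-- The Lagrangian `ℒ(x, u)`. -/
def lagrangian (x : EuclideanSpace ℝ (Fin n)) (u : DualSpace m p) : ℝ :=
  P.f x + ∑ i, u (Sum.inl i) * P.g i x + ∑ j, u (Sum.inr j) * P.eqResidual x j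

/-- `x` minimizes `ℒ(·, u)` over `X`. -/
def IsLagrangianMinimizer (u : DualSpace m p) (x : EuclideanSpace ℝ (Fin n)) : Prop :=
  x ∈ P.X ∧ IsMinOn (fun y => P.lagrangian y u) P.X x

/-- `x̄(u)`, a minimizer of `ℒ(·, u)` over `X` (an arbitrary point if there is none). -/
def xbar (u : DualSpace m p) : EuclideanSpace ℝ (Fin n) :=
  Classical.epsilon (P.IsLagrangianMinimizer u)

/-- The dual function `d(u) = min_{x ∈ X} ℒ(x, u)`. -/
def dual (u : DualSpace m p) : ℝ := sInf ((fun x => P.lagrangian x u) '' P.X)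

end ConvexProgram

/-- The dual feasible set `D`. -/
def dualDomain (m p : ℕ) : Set (DualSpace m p) := {u | ∀ i, 0 ≤ u (Sum.inl i)}

namespace ConvexProgram

variable {n m p : ℕ} (P : ConvexProgram n m p)

/-- `d⋆`, the dual optimal value. -/
def dualValue : ℝ := sSup (P.dual '' dualDomain m p)

/-- `D⋆`, the set of dual optimal solutions. -/
def dualSolutions : Set (DualSpace m p) :=
  {u | u ∈ dualDomain m p ∧ IsMaxOn P.dual (dualDomain m p) u}

/-- `∇d(u)` for `u ∈ D`. The gradient is taken relative to `D`, because `d` can fail to be finite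
outside `D`. -/
def dualGrad (u : DualSpace m p) : DualSpace m p := gradientWithin P.dual (dualDomain m p) u

/-- The infeasibility measure `Δ(x)`. -/
def infeasibility (x : EuclideanSpace ℝ (Fin n)) : ℝ :=
  Real.sqrt (‖P.eqResidual x‖ ^ 2 + ∑ i, (max 0 (P.g i x)) ^ 2)

/-- `G(u) = ⋃ᵢ ∂gⁱ(x̄(u))`. -/
def subgradSet (u : DualSpace m p) : Set (EuclideanSpace ℝ (Fin n)) :=
  ⋃ i, subdifferential (P.g i) (P.xbar u)

/-- The set `⋃_{u ∈ D} G(u)` is bounded. -/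
def BoundedSubgradients : Prop :=
  Bornology.IsBounded (⋃ u ∈ dualDomain m p, P.subgradSet u)

/-- `γ(u) = √(m+1)/θ · max {σ_max(A), sup_{q ∈ G(u)} ‖q‖}`; the supremum is `0` if `m = 0`. -/
def gamma (θ : ℝ) (u : DualSpace m p) : ℝ :=
  Real.sqrt (m + 1) / θ * max P.sigmaMax (sSup (norm '' P.subgradSet u))

/-- `L̃ = sup_{u ∈ D} γ(u) · (σ_max(A)² + ∑ᵢ Lᵢ²)^{1/2}`. -/
def lipConst (θ : ℝ) (L : Fin m → ℝ) : ℝ :=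
  sSup (P.gamma θ '' dualDomain m p) * Real.sqrt (P.sigmaMax ^ 2 + ∑ i, L i ^ 2)

/-- `ℓ_{-d}(u, v) = -d(v) - ∇d(v)ᵀ(u - v)`. -/
def linModel (u v : DualSpace m p) : ℝ := -P.dual v - inner ℝ (P.dualGrad v) (u - v)

end ConvexProgram

/-- `Q(u, v) = h(u) - h(v) - ∇h(v)ᵀ(u - v)`. -/
def bregman {m p : ℕ} (h : DualSpace m p → ℝ) (u v : DualSpace m p) : ℝ :=
  h u - h v - inner ℝ (gradient h v) (u - v)

/-- Conditions on the function `h` that generates `Q`. -/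
structure IsProxFunction {m p : ℕ} (h : DualSpace m p → ℝ) : Prop where
  differentiable : ∃ O : Set (DualSpace m p),
    IsOpen O ∧ dualDomain m p ⊆ O ∧ DifferentiableOn ℝ h O
  strictConvex : StrictConvexOn ℝ (dualDomain m p) h
  le_bregman : ∀ u ∈ dualDomain m p, ∀ v ∈ dualDomain m p, ‖u - v‖ ^ 2 / 2 ≤ bregman h u v

/-- `(u, v, w, β, U)` is a run of the 1-memory fast gradient method applied to the dual problem,
with constant `Lt` and distance-generating function `h`. -/
structure IsFastGradientRun {n m p : ℕ} (P : ConvexProgram n m p) (Lt : ℝ)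
    (h : DualSpace m p → ℝ) (u v w : ℕ → DualSpace m p) (β : ℕ → ℝ)
    (U : ℕ → Set (DualSpace m p)) : Prop where
  beta_zero : β 0 = 1
  u_mem : ∀ k, u k ∈ dualDomain m p
  w_zero_mem : w 0 ∈ dualDomain m p
  U_closed : ∀ k, IsClosed (U k)
  U_convex : ∀ k, Convex ℝ (U k)
  U_inter : ∀ k, (U k ∩ P.dualSolutions).Nonempty
  v_eq : ∀ k, v k = (1 - β k) • u k + β k • w k
  w_mem : ∀ k, w (k + 1) ∈ U k ∩ dualDomain m p
  w_min : ∀ k, IsMinOn (fun z => P.linModel z (v k) + β k * Lt * bregman h z (w k))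
    (U k ∩ dualDomain m p) (w (k + 1))
  u_step : ∀ k,
    P.linModel (u (k + 1)) (v k) + Lt / 2 * ‖u (k + 1) - v k‖ ^ 2 ≤
      P.linModel ((1 - β k) • u k + β k • w (k + 1)) (v k) +
        Lt / 2 * ‖((1 - β k) • u k + β k • w (k + 1)) - v k‖ ^ 2
  beta_pos : ∀ k, 0 < β (k + 1)
  beta_le : ∀ k, β (k + 1) ≤ 2 / ((k : ℝ) + 3)
  beta_step : ∀ k, (1 - β (k + 1)) / β (k + 1) ^ 2 ≤ 1 / β k ^ 2

end

/-! Write c(x) = (g(x), Ax + b). For u in D the Lagrangian inherits the θ-strong convexity of f, so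
it has a unique minimizer x̄(u) with quadratic growth. Testing the growth for u at x̄(v) gives
`Regular.dual_le`: c(x̄(v)) is a supergradient of d at v, with surplus (θ/2)‖x̄(u) - x̄(v)‖². Two
Lipschitz bounds for c, multiplied, give ‖c(x̄(u)) - c(x̄(v))‖² ≤ θ L̃ ‖x̄(u) - x̄(v)‖². The surplus
then absorbs the change of supergradient, which yields the descent lemma `Regular.le_dual` and ∇d =
c ∘ x̄ on D.

The usual potential argument for accelerated gradient methods (`dual_gap_step`, `dual_gap_le`) now
bounds the dual gap. First-order optimality of u⋆ is the KKT system for x̄(u⋆), so x⋆ = x̄(u⋆) and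
f⋆ = d⋆. Weak duality with the surplus kept bounds (θ/2)‖x̄(u_k) - x⋆‖² by the dual gap, hence also
‖c(x̄(u_k)) - c(x⋆)‖; the primal value and infeasibility estimates follow from the latter. -/

/-! ### Strongly convex minimization and first-order conditions. -/

section Convex

variable {E : Type*} [NormedAddCommGroup E] [InnerProductSpace ℝ E]

/-- A function with strongly convex subgradient inequalities on a closed convex set attains its
minimum there, with quadratic growth away from the minimizer. -/
theorem exists_forall_quadratic_growth [FiniteDimensional ℝ E] {X : Set E} (hX : IsClosed X)
    (hc : Convex ℝ X) (hne : X.Nonempty) {φ : E → ℝ} {θ : ℝ} (hθ : 0 < θ)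
    (hφ : ∀ x ∈ X, ∃ s : E, ∀ y ∈ X, φ x + inner ℝ s (y - x) + θ / 2 * ‖y - x‖ ^ 2 ≤ φ y) :
    ∃ x ∈ X, ∀ y ∈ X, φ x + θ / 2 * ‖y - x‖ ^ 2 ≤ φ y := by
  obtain ⟨x₀, hx₀⟩ := hne
  obtain ⟨s, hs⟩ := hφ x₀ hx₀
  -- Beyond distance R from x₀ the quadratic term outweighs the linear one, so φ ≥ φ x₀ there.
  set R : ℝ := 2 * ‖s‖ / θ
  have hR : 0 ≤ R := by positivity
  have hK : IsCompact (X ∩ Metric.closedBall x₀ R) := (isCompact_closedBall x₀ R).inter_left hX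
  -- The subgradient at x gives an affine minorant of φ on X that is exact at x.
  have hlsc : LowerSemicontinuousOn φ (X ∩ Metric.closedBall x₀ R) := by
    intro x hx a ha
    obtain ⟨q, hq⟩ := hφ x hx.1
    have hcont : Continuous fun y => φ x + inner ℝ q (y - x) := by fun_prop
    have hlt : a < φ x + inner ℝ q (x - x) := by simpa using ha
    filter_upwards [self_mem_nhdsWithin,
      (hcont.continuousAt.eventually (lt_mem_nhds hlt)).filter_mono nhdsWithin_le_nhds] with y hy h
    have : 0 ≤ θ / 2 * ‖y - x‖ ^ 2 := by positivity
    linarith [hq y hy.1]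
  have hne : (X ∩ Metric.closedBall x₀ R).Nonempty := ⟨x₀, hx₀, Metric.mem_closedBall_self hR⟩
  obtain ⟨x, hx, hmin⟩ := LowerSemicontinuousOn.exists_isMinOn hne hK hlsc
  have hmin' : ∀ y ∈ X, φ x ≤ φ y := by
    intro y hy
    by_cases hyR : y ∈ Metric.closedBall x₀ R
    · exact hmin ⟨hy, hyR⟩
    · have h0 : φ x ≤ φ x₀ := hmin ⟨hx₀, Metric.mem_closedBall_self hR⟩
      have h1 := hs y hy
      have h2 : -(‖s‖ * ‖y - x₀‖) ≤ inner ℝ s (y - x₀) :=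
        (abs_le.1 (abs_real_inner_le_norm s (y - x₀))).1
      rw [Metric.mem_closedBall, dist_eq_norm, not_le, div_lt_iff₀ hθ] at hyR
      nlinarith [norm_nonneg (y - x₀)]
  refine ⟨x, hx.1, fun y hy => ?_⟩
  -- Weighting the inequalities based at x + t(y - x) by 1 - t and t cancels the linear terms and
  -- leaves (θ/2)t(1 - t)‖y - x‖²; divide by t, then let t → 0.
  have key : ∀ t : ℝ, 0 < t → t < 1 → φ x + θ / 2 * (1 - t) * ‖y - x‖ ^ 2 ≤ φ y := by
    intro t ht ht1
    have hz : x + t • (y - x) ∈ X := hc.add_smul_sub_mem hx.1 hy ⟨ht.le, ht1.le⟩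
    obtain ⟨q, hq⟩ := hφ _ hz
    have h1 := hq x hx.1
    have h2 := hq y hy
    have e1 : x - (x + t • (y - x)) = (-t) • (y - x) := by module
    have e2 : y - (x + t • (y - x)) = (1 - t) • (y - x) := by module
    rw [e1, norm_smul, inner_smul_right, mul_pow, Real.norm_eq_abs, sq_abs] at h1
    rw [e2, norm_smul, inner_smul_right, mul_pow, Real.norm_eq_abs, sq_abs] at h2
    have h3 := hmin' _ hz
    have h4 := mul_le_mul_of_nonneg_left h1 (sub_nonneg.2 ht1.le)
    have h5 := mul_le_mul_of_nonneg_left h2 ht.le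
    refine le_of_mul_le_mul_left ?_ ht
    linarith
  have hlim : Tendsto (fun t : ℝ => φ x + θ / 2 * (1 - t) * ‖y - x‖ ^ 2) (𝓝[>] 0)
      (𝓝 (φ x + θ / 2 * ‖y - x‖ ^ 2)) := by
    have hcont : Continuous fun t : ℝ => φ x + θ / 2 * (1 - t) * ‖y - x‖ ^ 2 := by fun_prop
    simpa using (hcont.tendsto 0).mono_left nhdsWithin_le_nhds
  refine le_of_tendsto hlim ?_
  filter_upwards [Ioo_mem_nhdsGT (zero_lt_one' ℝ)] with t ht using key t ht.1 ht.2

theorem hasGradientWithinAt_of_abs_le_mul_sq [CompleteSpace E] {d : E → ℝ} {q v : E} {D : Set E}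
    {K : ℝ} (hK : ∀ u ∈ D, |d u - d v - inner ℝ q (u - v)| ≤ K * ‖u - v‖ ^ 2) :
    HasGradientWithinAt d q D v := by
  rw [hasGradientWithinAt_iff_isLittleO]
  have h1 : (fun u => d u - d v - inner ℝ q (u - v)) =O[𝓝[D] v] fun u => ‖u - v‖ ^ 2 := by
    refine Asymptotics.IsBigO.of_bound K ?_
    filter_upwards [self_mem_nhdsWithin] with u hu
    simpa using hK u hu
  have h2 : (fun u : E => ‖u - v‖ ^ 2) =o[𝓝[D] v] fun u => u - v := by
    refine Asymptotics.IsLittleO.mono ?_ nhdsWithin_le_nhds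
    exact Asymptotics.isLittleO_pow_sub_sub v one_lt_two
  exact h1.trans_isLittleO h2

theorem IsMinOn.inner_gradient_nonneg [CompleteSpace E] {f : E → ℝ} {q x y : E} {S : Set E}
    (hS : Convex ℝ S) (hf : IsMinOn f S x) (hq : HasGradientWithinAt f q S x) (hx : x ∈ S)
    (hy : y ∈ S) : 0 ≤ inner ℝ q (y - x) := by
  simpa using hf.localize.hasFDerivWithinAt_nonneg hq.hasFDerivWithinAt
    (sub_mem_posTangentConeAt_of_segment_subset (hS.segment_subset hx hy))

end Convex

/-! ### Geometry of the dual domain. -/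

section DualDomain

variable {m p : ℕ}

theorem convex_dualDomain : Convex ℝ (dualDomain m p) := by
  intro x hx y hy a b ha hb _ i
  simpa using add_nonneg (mul_nonneg ha (hx i)) (mul_nonneg hb (hy i))

/-- A convex set with interior points determines relative gradients uniquely, also on its boundary;
this is what makes `dualGrad` computable. -/
theorem uniqueDiffOn_dualDomain : UniqueDiffOn ℝ (dualDomain m p) := by
  refine uniqueDiffOn_convex convex_dualDomain ⟨WithLp.toLp 2 fun _ => 1, ?_⟩
  have hopen : IsOpen {u : DualSpace m p | ∀ i, 0 < u (Sum.inl i)} := by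
    simp only [Set.ofPred_forall]
    exact isOpen_iInter_of_finite fun i => isOpen_lt continuous_const (by fun_prop)
  exact interior_maximal (fun u hu i => (hu i).le) hopen (fun i => by simp)

theorem gradientWithin_dualDomain_eq {d : DualSpace m p → ℝ} {q v : DualSpace m p}
    (hq : HasGradientWithinAt d q (dualDomain m p) v) (hv : v ∈ dualDomain m p) :
    gradientWithin d (dualDomain m p) v = q := by
  unfold gradientWithin
  rw [hq.hasFDerivWithinAt.fderivWithin (uniqueDiffOn_dualDomain v hv)]
  simp

/-- Optimality conditions for the maximization of a function with gradient `q` over `D`. -/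
theorem complementarity_of_variational_inequality {q z : DualSpace m p} (hz : z ∈ dualDomain m p)
    (hq : ∀ u ∈ dualDomain m p, inner ℝ q (u - z) ≤ 0) :
    inner ℝ q z = 0 ∧ (∀ i, q (Sum.inl i) ≤ 0) ∧ ∀ j, q (Sum.inr j) = 0 := by
  -- D is a cone, so 0 and 2z are admissible test points; the signs of the coordinates of q come
  -- from testing with ± unit vectors.
  have h0 : inner ℝ q z = 0 := by
    have h1 := hq 0 (fun i => by simp)
    have h2 := hq ((2 : ℝ) • z) (fun i => by simpa using hz i)
    rw [inner_sub_right, inner_zero_right] at h1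
    rw [inner_sub_right, inner_smul_right] at h2
    linarith
  have h1 : ∀ u ∈ dualDomain m p, inner ℝ q u ≤ 0 := fun u hu => by
    have := hq u hu
    rw [inner_sub_right] at this
    linarith
  refine ⟨h0, fun i => ?_, fun j => le_antisymm ?_ ?_⟩
  · simpa [EuclideanSpace.inner_single_right] using
      h1 (EuclideanSpace.single (Sum.inl i) 1) (fun k => by
      simp only [PiLp.single_apply]; split_ifs <;> norm_num)
  · simpa [EuclideanSpace.inner_single_right] using
      h1 (EuclideanSpace.single (Sum.inr j) 1) (fun k => by simp)
  · simpa [EuclideanSpace.inner_single_right] using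
      h1 (EuclideanSpace.single (Sum.inr j) (-1)) (fun k => by simp)

/-- Hölder between ℓ^∞ and ℓ¹, then Cauchy–Schwarz on the m + p coordinates: the source of the
factor √(m + p). -/
theorem abs_inner_le_iSup_abs_mul_norm (x y : DualSpace m p) :
    |inner ℝ x y| ≤ (⨆ i, |x i|) * (Real.sqrt ((m : ℝ) + p) * ‖y‖) := by
  have hb : ∀ i, |x i| ≤ ⨆ i, |x i| := fun i => le_ciSup (Finite.bddAbove_range fun i => |x i|) i
  have h0 : 0 ≤ ⨆ i, |x i| := Real.iSup_nonneg fun i => abs_nonneg _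
  have h1 : ∑ i, |y i| ≤ Real.sqrt ((m : ℝ) + p) * ‖y‖ := by
    refine abs_le_of_sq_le_sq' ?_ (by positivity) |>.2
    rw [mul_pow, Real.sq_sqrt (by positivity), EuclideanSpace.norm_sq_eq]
    have := sq_sum_le_card_mul_sum_sq (s := (Finset.univ : Finset (Fin m ⊕ Fin p)))
      (f := fun i => |y i|)
    simpa using this
  calc |inner ℝ x y| = |∑ i, x i * y i| := by
        simp [PiLp.inner_apply, mul_comm]
    _ ≤ ∑ i, |x i| * |y i| := by
        simpa [abs_mul] using Finset.abs_sum_le_sum_abs (fun i => x i * y i) Finset.univ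
    _ ≤ ∑ i, (⨆ i, |x i|) * |y i| :=
        Finset.sum_le_sum fun i _ => mul_le_mul_of_nonneg_right (hb i) (abs_nonneg _)
    _ = (⨆ i, |x i|) * ∑ i, |y i| := by rw [Finset.mul_sum]
    _ ≤ _ := mul_le_mul_of_nonneg_left h1 h0

end DualDomain

/-! ### The constraint map, Lagrangian minimizers and the dual function. -/

namespace ConvexProgram

variable {n m p : ℕ} (P : ConvexProgram n m p)

/-- The values `(g(x), A x + b)` of the constraint functions at `x`. -/
noncomputable def constraintMap (x : EuclideanSpace ℝ (Fin n)) : DualSpace m p :=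
  WithLp.toLp 2 (Sum.elim (fun i => P.g i x) fun j => P.eqResidual x j)

@[simp] theorem constraintMap_inl (x : EuclideanSpace ℝ (Fin n)) (i : Fin m) :
    P.constraintMap x (Sum.inl i) = P.g i x := rfl

@[simp] theorem constraintMap_inr (x : EuclideanSpace ℝ (Fin n)) (j : Fin p) :
    P.constraintMap x (Sum.inr j) = P.eqResidual x j := rfl

theorem lagrangian_eq (x : EuclideanSpace ℝ (Fin n)) (u : DualSpace m p) :
    P.lagrangian x u = P.f x + inner ℝ (P.constraintMap x) u := by
  simp [lagrangian, PiLp.inner_apply, Fintype.sum_sum_type, add_assoc]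

theorem norm_constraintMap_sub_sq (x y : EuclideanSpace ℝ (Fin n)) :
    ‖P.constraintMap x - P.constraintMap y‖ ^ 2 =
      ∑ i, (P.g i x - P.g i y) ^ 2 + ‖P.eqResidual x - P.eqResidual y‖ ^ 2 := by
  simp [EuclideanSpace.norm_sq_eq, Fintype.sum_sum_type]

theorem norm_eqResidual_sub_le (x y : EuclideanSpace ℝ (Fin n)) :
    ‖P.eqResidual x - P.eqResidual y‖ ≤ P.sigmaMax * ‖x - y‖ := by
  have h := (Matrix.toEuclideanLin P.A).toContinuousLinearMap.le_opNorm (x - y)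
  simpa [eqResidual, sigmaMax] using h

theorem sigmaMax_nonneg : 0 ≤ P.sigmaMax := norm_nonneg _

variable {P} {θ : ℝ} {L : Fin m → ℝ}

theorem Regular.nonempty_X (hP : P.Regular θ L) : P.X.Nonempty :=
  let ⟨x, hx, _⟩ := hP.slater
  ⟨x, intrinsicInterior_subset hx⟩

/-- Add subgradients of f and of the g i, weighted by u, and the adjoint of A applied to the
equality multipliers. Nonnegativity of the weights preserves the inequalities; f alone supplies the
quadratic term. -/
theorem Regular.exists_lagrangian_subgradient (hP : P.Regular θ L) {u : DualSpace m p}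
    (hu : u ∈ dualDomain m p) {x : EuclideanSpace ℝ (Fin n)} (hx : x ∈ P.X) :
    ∃ s : EuclideanSpace ℝ (Fin n), ∀ y ∈ P.X,
      P.lagrangian x u + inner ℝ s (y - x) + θ / 2 * ‖y - x‖ ^ 2 ≤ P.lagrangian y u := by
  obtain ⟨s, hs⟩ := hP.subdifferentiable_f x hx
  choose q hq using fun i => hP.subdifferentiable_g i x hx
  set r : EuclideanSpace ℝ (Fin p) := WithLp.toLp 2 fun j => u (Sum.inr j)
  refine ⟨s + ∑ i, u (Sum.inl i) • q i + LinearMap.adjoint (Matrix.toEuclideanLin P.A) r,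
    fun y hy => ?_⟩
  have h1 := hP.strongly_convex_f x hx y hy s hs
  have h2 : ∑ i, u (Sum.inl i) * (P.g i x + inner ℝ (q i) (y - x)) ≤
      ∑ i, u (Sum.inl i) * P.g i y := Finset.sum_le_sum fun i _ =>
    mul_le_mul_of_nonneg_left
      (subgradient_inequality_of_convexOn (hP.convex_g i) hx hy (hq i)) (hu i)
  have h3 : ∀ z, ∑ j, u (Sum.inr j) * P.eqResidual z j = inner ℝ r (P.eqResidual z) := fun z => by
    simp [PiLp.inner_apply, r, mul_comm]
  have h4 : inner ℝ r (P.eqResidual y) = inner ℝ r (P.eqResidual x) +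
      inner ℝ (LinearMap.adjoint (Matrix.toEuclideanLin P.A) r) (y - x) := by
    rw [LinearMap.adjoint_inner_left, ← inner_add_right]
    congr 1
    simp [eqResidual]
    abel
  simp only [mul_add, Finset.sum_add_distrib] at h2
  simp only [lagrangian, h3, h4, inner_add_left, sum_inner, real_inner_smul_left]
  rw [norm_sub_rev] at h1
  linarith

/-- The Lagrangian minimizer exists, and the Lagrangian grows quadratically away from it. -/
theorem Regular.xbar_spec (hP : P.Regular θ L) {u : DualSpace m p} (hu : u ∈ dualDomain m p) :
    P.xbar u ∈ P.X ∧ ∀ y ∈ P.X,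
      P.lagrangian (P.xbar u) u + θ / 2 * ‖y - P.xbar u‖ ^ 2 ≤ P.lagrangian y u := by
  have hθ := hP.theta_pos
  obtain ⟨x, hx, hgrow⟩ := exists_forall_quadratic_growth hP.isClosed_X hP.convex_X hP.nonempty_X
    hP.theta_pos fun x hx => hP.exists_lagrangian_subgradient hu hx
  have hxmin : P.IsLagrangianMinimizer u x := ⟨hx, fun y hy => by
    have : 0 ≤ θ / 2 * ‖y - x‖ ^ 2 := by positivity
    exact (le_add_of_nonneg_right this).trans (hgrow y hy)⟩
  have hbar : P.IsLagrangianMinimizer u (P.xbar u) := Classical.epsilon_spec ⟨x, hxmin⟩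
  -- `xbar` is an arbitrary choice among the minimizers, so it must be identified with the point x
  -- that carries the growth estimate.
  have heq : P.xbar u = x := by
    have h1 := hgrow _ hbar.1
    have h2 : P.lagrangian (P.xbar u) u ≤ P.lagrangian x u := hbar.2 hx
    have h3 : ‖P.xbar u - x‖ ^ 2 ≤ 0 := by
      by_contra! h
      have : 0 < θ / 2 * ‖P.xbar u - x‖ ^ 2 := by positivity
      linarith
    rwa [sq_nonpos_iff, norm_eq_zero, sub_eq_zero] at h3
  rw [heq]
  exact ⟨hx, hgrow⟩

theorem Regular.isLagrangianMinimizer_xbar (hP : P.Regular θ L) {u : DualSpace m p}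
    (hu : u ∈ dualDomain m p) : P.IsLagrangianMinimizer u (P.xbar u) :=
  ⟨(hP.xbar_spec hu).1, fun y hy => by
    have hθ := hP.theta_pos
    have : 0 ≤ θ / 2 * ‖y - P.xbar u‖ ^ 2 := by positivity
    exact (le_add_of_nonneg_right this).trans ((hP.xbar_spec hu).2 y hy)⟩

theorem Regular.eq_xbar (hP : P.Regular θ L) {u : DualSpace m p} (hu : u ∈ dualDomain m p)
    {x : EuclideanSpace ℝ (Fin n)} (hx : x ∈ P.X)
    (hle : P.lagrangian x u ≤ P.lagrangian (P.xbar u) u) : x = P.xbar u := by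
  have hθ := hP.theta_pos
  have h1 := (hP.xbar_spec hu).2 x hx
  have h3 : ‖x - P.xbar u‖ ^ 2 ≤ 0 := by
    by_contra! h
    have : 0 < θ / 2 * ‖x - P.xbar u‖ ^ 2 := by positivity
    linarith
  rwa [sq_nonpos_iff, norm_eq_zero, sub_eq_zero] at h3

theorem Regular.dual_eq (hP : P.Regular θ L) {u : DualSpace m p} (hu : u ∈ dualDomain m p) :
    P.dual u = P.lagrangian (P.xbar u) u :=
  IsLeast.csInf_eq ⟨⟨_, (hP.xbar_spec hu).1, rfl⟩, by
    rintro _ ⟨y, hy, rfl⟩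
    exact (hP.isLagrangianMinimizer_xbar hu).2 hy⟩

theorem Regular.dual_add_le_lagrangian (hP : P.Regular θ L) {u : DualSpace m p}
    (hu : u ∈ dualDomain m p) {y : EuclideanSpace ℝ (Fin n)} (hy : y ∈ P.X) :
    P.dual u + θ / 2 * ‖y - P.xbar u‖ ^ 2 ≤ P.lagrangian y u := by
  rw [hP.dual_eq hu]
  exact (hP.xbar_spec hu).2 y hy

/-- Quadratic growth of ℒ(·, u) tested at x̄(v), where ℒ is affine in its second argument. -/
theorem Regular.dual_le (hP : P.Regular θ L) {u v : DualSpace m p} (hu : u ∈ dualDomain m p)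
    (hv : v ∈ dualDomain m p) :
    P.dual u + θ / 2 * ‖P.xbar u - P.xbar v‖ ^ 2 ≤
      P.dual v + inner ℝ (P.constraintMap (P.xbar v)) (u - v) := by
  have h := hP.dual_add_le_lagrangian hu (hP.xbar_spec hv).1
  rw [hP.dual_eq hv, P.lagrangian_eq _ v, inner_sub_right]
  rw [P.lagrangian_eq, norm_sub_rev] at h
  linarith

/-! ### Lipschitz bounds for the constraint values and smoothness of the dual. -/

theorem Regular.norm_constraintMap_sub_le (hP : P.Regular θ L) {x y : EuclideanSpace ℝ (Fin n)}
    (hx : x ∈ P.X) (hy : y ∈ P.X) :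
    ‖P.constraintMap x - P.constraintMap y‖ ≤
      Real.sqrt (P.sigmaMax ^ 2 + ∑ i, L i ^ 2) * ‖x - y‖ := by
  refine abs_le_of_sq_le_sq' ?_ (by positivity) |>.2
  have h0 : 0 ≤ ∑ i, L i ^ 2 := Finset.sum_nonneg fun i _ => sq_nonneg _
  rw [mul_pow, Real.sq_sqrt (by positivity), norm_constraintMap_sub_sq, add_mul, Finset.sum_mul,
    add_comm]
  refine add_le_add ?_ (Finset.sum_le_sum fun i _ => ?_)
  · rw [← mul_pow]
    exact pow_le_pow_left₀ (norm_nonneg _) (P.norm_eqResidual_sub_le x y) 2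
  · rw [← mul_pow, ← sq_abs (P.g i x - P.g i y)]
    exact pow_le_pow_left₀ (abs_nonneg _) (hP.lipschitz_g i x hx y hy) 2

theorem BoundedSubgradients.exists_bound (hG : P.BoundedSubgradients) :
    ∃ C, 0 ≤ C ∧ ∀ u ∈ dualDomain m p, ∀ q ∈ P.subgradSet u, ‖q‖ ≤ C := by
  obtain ⟨C, hC0, hC⟩ := Bornology.IsBounded.exists_pos_norm_le hG
  exact ⟨C, hC0.le, fun u hu q hq => hC q (Set.mem_biUnion hu hq)⟩

theorem gamma_nonneg (hθ : 0 < θ) (u : DualSpace m p) : 0 ≤ P.gamma θ u :=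
  mul_nonneg (by positivity) (le_max_of_le_left P.sigmaMax_nonneg)

theorem BoundedSubgradients.bddAbove_gamma (hG : P.BoundedSubgradients) (hθ : 0 < θ) :
    BddAbove (P.gamma θ '' dualDomain m p) := by
  obtain ⟨C, hC0, hC⟩ := hG.exists_bound
  refine ⟨Real.sqrt (m + 1) / θ * max P.sigmaMax C, ?_⟩
  rintro _ ⟨u, hu, rfl⟩
  refine mul_le_mul_of_nonneg_left (max_le_max le_rfl (Real.sSup_le ?_ hC0)) (by positivity)
  rintro _ ⟨q, hq, rfl⟩
  exact hC u hu q hq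

theorem sSup_gamma_nonneg (hθ : 0 < θ) : 0 ≤ sSup (P.gamma θ '' dualDomain m p) :=
  Real.sSup_nonneg (by rintro _ ⟨u, -, rfl⟩; exact gamma_nonneg hθ u)

theorem lipConst_nonneg (hθ : 0 < θ) : 0 ≤ P.lipConst θ L :=
  mul_nonneg (sSup_gamma_nonneg hθ) (Real.sqrt_nonneg _)

theorem BoundedSubgradients.sqrt_mul_sigmaMax_le (hG : P.BoundedSubgradients) (hθ : 0 < θ) :
    Real.sqrt (m + 1) * P.sigmaMax ≤ θ * sSup (P.gamma θ '' dualDomain m p) := by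
  have h := le_csSup (hG.bddAbove_gamma hθ)
    (Set.mem_image_of_mem (P.gamma θ) (show (0 : DualSpace m p) ∈ dualDomain m p from
      fun i => by simp))
  have h1 : Real.sqrt (m + 1) / θ * P.sigmaMax ≤ P.gamma θ 0 :=
    mul_le_mul_of_nonneg_left (le_max_left _ _) (by positivity)
  have h2 := h1.trans h
  rw [div_mul_eq_mul_div, div_le_iff₀ hθ] at h2
  linarith

theorem BoundedSubgradients.sqrt_mul_norm_le (hG : P.BoundedSubgradients) (hθ : 0 < θ)
    {u : DualSpace m p} (hu : u ∈ dualDomain m p) {q : EuclideanSpace ℝ (Fin n)}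
    (hq : q ∈ P.subgradSet u) :
    Real.sqrt (m + 1) * ‖q‖ ≤ θ * sSup (P.gamma θ '' dualDomain m p) := by
  obtain ⟨C, -, hC⟩ := hG.exists_bound
  have h := le_csSup (hG.bddAbove_gamma hθ) (Set.mem_image_of_mem (P.gamma θ) hu)
  have h0 : ‖q‖ ≤ sSup (norm '' P.subgradSet u) :=
    le_csSup ⟨C, by rintro _ ⟨q, hq, rfl⟩; exact hC u hu q hq⟩ (Set.mem_image_of_mem _ hq)
  have h1 : Real.sqrt (m + 1) / θ * ‖q‖ ≤ P.gamma θ u :=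
    mul_le_mul_of_nonneg_left (h0.trans (le_max_right _ _)) (by positivity)
  have h2 := h1.trans h
  rw [div_mul_eq_mul_div, div_le_iff₀ hθ] at h2
  linarith

/-- Convexity bounds the difference by a subgradient at x̄(u), which lies in G(u). The bound is
one-sided; exchanging u and v gives the other side. -/
theorem Regular.sqrt_mul_g_sub_le (hP : P.Regular θ L) (hG : P.BoundedSubgradients)
    {u v : DualSpace m p} (hu : u ∈ dualDomain m p) (hv : v ∈ dualDomain m p) (i : Fin m) :
    Real.sqrt (m + 1) * (P.g i (P.xbar u) - P.g i (P.xbar v)) ≤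
      θ * sSup (P.gamma θ '' dualDomain m p) * ‖P.xbar u - P.xbar v‖ := by
  obtain ⟨q, hq⟩ := hP.subdifferentiable_g i _ (hP.xbar_spec hu).1
  have h1 := subgradient_inequality_of_convexOn (hP.convex_g i) (hP.xbar_spec hu).1
    (hP.xbar_spec hv).1 hq
  have h2 := (abs_le.1 (abs_real_inner_le_norm q (P.xbar v - P.xbar u))).1
  have h3 := hG.sqrt_mul_norm_le hP.theta_pos hu (Set.mem_iUnion.2 ⟨i, hq⟩)
  rw [norm_sub_rev (P.xbar v)] at h2
  calc Real.sqrt (m + 1) * (P.g i (P.xbar u) - P.g i (P.xbar v))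
      ≤ Real.sqrt (m + 1) * (‖q‖ * ‖P.xbar u - P.xbar v‖) :=
        mul_le_mul_of_nonneg_left (by linarith) (Real.sqrt_nonneg _)
    _ = Real.sqrt (m + 1) * ‖q‖ * ‖P.xbar u - P.xbar v‖ := by ring
    _ ≤ _ := mul_le_mul_of_nonneg_right h3 (norm_nonneg _)

/-- The m inequality components and the single equality block each contribute at most M²/(m + 1) to
the squared norm, whence √(m + 1) in γ. -/
theorem Regular.norm_constraintMap_xbar_sub_le (hP : P.Regular θ L) (hG : P.BoundedSubgradients)
    {u v : DualSpace m p} (hu : u ∈ dualDomain m p) (hv : v ∈ dualDomain m p) :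
    ‖P.constraintMap (P.xbar u) - P.constraintMap (P.xbar v)‖ ≤
      θ * sSup (P.gamma θ '' dualDomain m p) * ‖P.xbar u - P.xbar v‖ := by
  set δ := ‖P.xbar u - P.xbar v‖
  set M := θ * sSup (P.gamma θ '' dualDomain m p) * δ with hM
  have hM0 : 0 ≤ M :=
    mul_nonneg (mul_nonneg hP.theta_pos.le (sSup_gamma_nonneg hP.theta_pos)) (norm_nonneg _)
  have hm : (0 : ℝ) < m + 1 := by positivity
  have hg : ∀ i, (m + 1) * (P.g i (P.xbar u) - P.g i (P.xbar v)) ^ 2 ≤ M ^ 2 := fun i => by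
    have h1 := hP.sqrt_mul_g_sub_le hG hu hv i
    have h2 := hP.sqrt_mul_g_sub_le hG hv hu i
    rw [norm_sub_rev] at h2
    have := sq_le_sq' (a := Real.sqrt (m + 1) * (P.g i (P.xbar u) - P.g i (P.xbar v)))
      (b := M) (by linarith) h1
    rwa [mul_pow, Real.sq_sqrt hm.le] at this
  have hA : (m + 1) * ‖P.eqResidual (P.xbar u) - P.eqResidual (P.xbar v)‖ ^ 2 ≤ M ^ 2 := by
    have h1 : Real.sqrt (m + 1) * ‖P.eqResidual (P.xbar u) - P.eqResidual (P.xbar v)‖ ≤ M := by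
      calc _ ≤ Real.sqrt (m + 1) * (P.sigmaMax * δ) :=
            mul_le_mul_of_nonneg_left (P.norm_eqResidual_sub_le _ _) (Real.sqrt_nonneg _)
        _ = Real.sqrt (m + 1) * P.sigmaMax * δ := by ring
        _ ≤ M := mul_le_mul_of_nonneg_right (hG.sqrt_mul_sigmaMax_le hP.theta_pos)
            (norm_nonneg _)
    have := pow_le_pow_left₀ (by positivity) h1 2
    rwa [mul_pow, Real.sq_sqrt hm.le] at this
  refine abs_le_of_sq_le_sq' ?_ hM0 |>.2
  rw [norm_constraintMap_sub_sq]
  have hsum : (m + 1) * ∑ i, (P.g i (P.xbar u) - P.g i (P.xbar v)) ^ 2 ≤ m * M ^ 2 := by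
    rw [Finset.mul_sum]
    simpa using Finset.sum_le_sum fun i (_ : i ∈ Finset.univ) => hg i
  refine le_of_mul_le_mul_left ?_ hm
  linarith

/-- Multiplying two different Lipschitz bounds, instead of squaring one, produces exactly θ L̃. -/
theorem Regular.norm_constraintMap_xbar_sub_sq_le (hP : P.Regular θ L)
    (hG : P.BoundedSubgradients) {u v : DualSpace m p} (hu : u ∈ dualDomain m p)
    (hv : v ∈ dualDomain m p) :
    ‖P.constraintMap (P.xbar u) - P.constraintMap (P.xbar v)‖ ^ 2 ≤
      θ * P.lipConst θ L * ‖P.xbar u - P.xbar v‖ ^ 2 := by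
  have h1 := hP.norm_constraintMap_xbar_sub_le hG hu hv
  have h2 := hP.norm_constraintMap_sub_le (hP.xbar_spec hu).1 (hP.xbar_spec hv).1
  have h3 := mul_le_mul h1 h2 (norm_nonneg _) ((norm_nonneg _).trans h1)
  rw [sq, lipConst]
  linarith

/-- The quadratic lower bound for the dual function (the descent lemma for `-d`). -/
theorem Regular.le_dual (hP : P.Regular θ L) (hG : P.BoundedSubgradients)
    {u v : DualSpace m p} (hu : u ∈ dualDomain m p) (hv : v ∈ dualDomain m p) :
    P.dual v + inner ℝ (P.constraintMap (P.xbar v)) (u - v) -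
      P.lipConst θ L / 2 * ‖u - v‖ ^ 2 ≤ P.dual u := by
  have hθ := hP.theta_pos
  have hL : 0 ≤ P.lipConst θ L := lipConst_nonneg hθ
  -- The roles of u and v are reversed: this bounds d(u) from below, but with the supergradient at u
  -- instead of v.
  have h1 := hP.dual_le hv hu
  set c := P.constraintMap (P.xbar u) - P.constraintMap (P.xbar v) with hc
  have h2 : inner ℝ (P.constraintMap (P.xbar u)) (v - u) =
      -inner ℝ (P.constraintMap (P.xbar v)) (u - v) - inner ℝ c (u - v) := by
    rw [hc, inner_sub_left, ← neg_sub u v, inner_neg_right]; ring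
  have h3 := (abs_le.1 (abs_real_inner_le_norm c (u - v))).1
  have h4 := hP.norm_constraintMap_xbar_sub_sq_le hG hu hv
  rw [norm_sub_rev] at h1
  set δ := ‖P.xbar u - P.xbar v‖
  -- Young's inequality for √θ δ and √L̃ ‖u - v‖; square roots avoid dividing by L̃, which may
  -- vanish.
  have h5 : ‖c‖ * ‖u - v‖ ≤ θ / 2 * δ ^ 2 + P.lipConst θ L / 2 * ‖u - v‖ ^ 2 := by
    have h6 : ‖c‖ ≤ Real.sqrt θ * Real.sqrt (P.lipConst θ L) * δ := by
      refine abs_le_of_sq_le_sq' ?_ (by positivity) |>.2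
      rw [mul_pow, mul_pow, Real.sq_sqrt hθ.le, Real.sq_sqrt hL]
      exact h4
    have h7 := mul_le_mul_of_nonneg_right h6 (norm_nonneg (u - v))
    have h8 := sq_nonneg (Real.sqrt θ * δ - Real.sqrt (P.lipConst θ L) * ‖u - v‖)
    have h9 : (Real.sqrt θ * δ - Real.sqrt (P.lipConst θ L) * ‖u - v‖) ^ 2 =
        θ * δ ^ 2 + P.lipConst θ L * ‖u - v‖ ^ 2 -
          2 * (Real.sqrt θ * Real.sqrt (P.lipConst θ L) * δ * ‖u - v‖) := by
      rw [sub_sq, mul_pow, mul_pow, Real.sq_sqrt hθ.le, Real.sq_sqrt hL]; ring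
    linarith
  linarith

/-- `dual_le` and `le_dual` enclose d between its linearization at v and the same minus (L̃/2)‖u -
v‖². -/
theorem Regular.hasGradientWithinAt_dual (hP : P.Regular θ L) (hG : P.BoundedSubgradients)
    {v : DualSpace m p} (hv : v ∈ dualDomain m p) :
    HasGradientWithinAt P.dual (P.constraintMap (P.xbar v)) (dualDomain m p) v := by
  have hθ := hP.theta_pos
  refine hasGradientWithinAt_of_abs_le_mul_sq (K := P.lipConst θ L / 2) fun u hu => ?_
  have h1 := hP.dual_le hu hv
  have h2 := hP.le_dual hG hu hv
  have h3 : 0 ≤ θ / 2 * ‖P.xbar u - P.xbar v‖ ^ 2 := by positivity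
  have h4 : 0 ≤ P.lipConst θ L / 2 * ‖u - v‖ ^ 2 :=
    mul_nonneg (div_nonneg (lipConst_nonneg hθ) zero_le_two) (sq_nonneg _)
  rw [abs_le]
  constructor <;> linarith

theorem Regular.dualGrad_eq (hP : P.Regular θ L) (hG : P.BoundedSubgradients)
    {v : DualSpace m p} (hv : v ∈ dualDomain m p) :
    P.dualGrad v = P.constraintMap (P.xbar v) :=
  gradientWithin_dualDomain_eq (hP.hasGradientWithinAt_dual hG hv) hv

theorem Regular.linModel_le (hP : P.Regular θ L) (hG : P.BoundedSubgradients)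
    {u v : DualSpace m p} (hu : u ∈ dualDomain m p) (hv : v ∈ dualDomain m p) :
    P.linModel u v ≤ -P.dual u := by
  have hθ := hP.theta_pos
  have h1 := hP.dual_le hu hv
  have h3 : 0 ≤ θ / 2 * ‖P.xbar u - P.xbar v‖ ^ 2 := by positivity
  rw [linModel, hP.dualGrad_eq hG hv]
  linarith

theorem Regular.neg_dual_le (hP : P.Regular θ L) (hG : P.BoundedSubgradients)
    {u v : DualSpace m p} (hu : u ∈ dualDomain m p) (hv : v ∈ dualDomain m p) :
    -P.dual u ≤ P.linModel u v + P.lipConst θ L / 2 * ‖u - v‖ ^ 2 := by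
  have h2 := hP.le_dual hG hu hv
  rw [linModel, hP.dualGrad_eq hG hv]
  linarith

theorem linModel_combo (x y v : DualSpace m p) (t : ℝ) :
    P.linModel ((1 - t) • x + t • y) v = (1 - t) * P.linModel x v + t * P.linModel y v := by
  simp only [linModel, inner_sub_right, inner_add_right, inner_smul_right]
  ring

end ConvexProgram

/-! ### Bregman distances and proximal steps. -/

section Bregman

variable {m p : ℕ} {h : DualSpace m p → ℝ}

theorem bregman_three_point (u v w : DualSpace m p) :
    bregman h u v =
      bregman h w v + bregman h u w + inner ℝ (gradient h w - gradient h v) (u - w) := by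
  simp only [bregman, inner_sub_left, inner_sub_right]
  ring

theorem IsProxFunction.hasGradientAt (hh : IsProxFunction h) {u : DualSpace m p}
    (hu : u ∈ dualDomain m p) : HasGradientAt h (gradient h u) u := by
  obtain ⟨O, hO, hDO, hd⟩ := hh.differentiable
  exact hd.hasGradientAt (hO.mem_nhds (hDO hu))

theorem IsProxFunction.bregman_nonneg (hh : IsProxFunction h) {u v : DualSpace m p}
    (hu : u ∈ dualDomain m p) (hv : v ∈ dualDomain m p) : 0 ≤ bregman h u v :=
  (by positivity : 0 ≤ ‖u - v‖ ^ 2 / 2).trans (hh.le_bregman u hu v hv)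

/-- The three-point inequality for a Bregman proximal step on an affine function. -/
theorem IsProxFunction.three_point_inequality (hh : IsProxFunction h) {C : Set (DualSpace m p)}
    (hC : Convex ℝ C) (hCD : C ⊆ dualDomain m p) {a : ℝ} {q v w x z : DualSpace m p} {c : ℝ}
    (hx : x ∈ C) (hz : z ∈ C)
    (hmin : IsMinOn (fun y => c - inner ℝ q (y - v) + a * bregman h y w) C x) :
    c - inner ℝ q (x - v) + a * bregman h x w + a * bregman h z x ≤
      c - inner ℝ q (z - v) + a * bregman h z w := by
  have hgrad : HasGradientWithinAt (fun y => c - inner ℝ q (y - v) + a * bregman h y w)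
      (-q + a • (gradient h x - gradient h w)) C x := by
    have hl : ∀ r v : DualSpace m p, HasFDerivAt (fun y => inner ℝ r (y - v)) (innerSL ℝ r) x :=
      fun r v => by
        simp only [inner_sub_right]
        exact (innerSL ℝ r).hasFDerivAt.sub_const _
    have h1 := ((hasFDerivAt_const c x).sub (hl q v)).add
      ((((hh.hasGradientAt (hCD hx)).hasFDerivAt.sub_const (h w)).sub
        (hl (gradient h w) w)).const_mul a)
    rw [hasGradientWithinAt_iff_hasFDerivWithinAt]
    refine (h1.congr_fderiv ?_).hasFDerivWithinAt
    ext y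
    simp
  -- The variational inequality at x tested with z; the three-point identity turns its ∇h term into
  -- Bregman distances.
  have h1 := hmin.inner_gradient_nonneg hC hgrad hx hz
  rw [inner_add_left, inner_neg_left, real_inner_smul_left] at h1
  rw [bregman_three_point z w x]
  have h2 : inner ℝ q (z - x) = inner ℝ q (z - v) - inner ℝ q (x - v) := by
    rw [← inner_sub_right]; congr 1; abel
  linarith

end Bregman

/-! ### Convergence of the fast gradient method in the dual. -/

namespace IsFastGradientRun

variable {n m p : ℕ} {P : ConvexProgram n m p} {θ : ℝ} {L : Fin m → ℝ} {h : DualSpace m p → ℝ}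
  {u v w : ℕ → DualSpace m p} {β : ℕ → ℝ} {U : ℕ → Set (DualSpace m p)} {Lt : ℝ}

theorem beta_le_two_div (hrun : IsFastGradientRun P Lt h u v w β U) (k : ℕ) :
    β k ≤ 2 / ((k : ℝ) + 2) := by
  cases k with
  | zero => rw [hrun.beta_zero]; norm_num
  | succ k =>
    have := hrun.beta_le k
    push_cast
    rwa [add_assoc, show (1 : ℝ) + 2 = 3 by norm_num]

theorem beta_positive (hrun : IsFastGradientRun P Lt h u v w β U) (k : ℕ) : 0 < β k := by
  cases k with
  | zero => rw [hrun.beta_zero]; norm_num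
  | succ k => exact hrun.beta_pos k

theorem beta_le_one (hrun : IsFastGradientRun P Lt h u v w β U) (k : ℕ) : β k ≤ 1 :=
  (hrun.beta_le_two_div k).trans (by
    rw [div_le_one (by positivity)]
    linarith [k.cast_nonneg' (α := ℝ)])

theorem w_mem_dualDomain (hrun : IsFastGradientRun P Lt h u v w β U) (k : ℕ) :
    w k ∈ dualDomain m p := by
  cases k with
  | zero => exact hrun.w_zero_mem
  | succ k => exact (hrun.w_mem k).2

theorem combo_mem_dualDomain (hrun : IsFastGradientRun P Lt h u v w β U) (k : ℕ)
    {z : DualSpace m p} (hz : z ∈ dualDomain m p) :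
    (1 - β k) • u k + β k • z ∈ dualDomain m p :=
  convex_dualDomain (hrun.u_mem k) hz (sub_nonneg.2 (hrun.beta_le_one k))
    (hrun.beta_positive k).le (by ring)

/-- By the descent lemma and the rule for u_{k+1}, -d(u_{k+1}) is at most the quadratic model at
û_{k+1}. There û_{k+1} - v_k = β_k(w_{k+1} - w_k), so the quadratic term is at most β_k² L̃
Q(w_{k+1}, w_k). The affine part splits: the u_k share is at most -d(u_k), the w_{k+1} share is
compared with z by the three-point inequality. -/
theorem dual_gap_step (hrun : IsFastGradientRun P (P.lipConst θ L) h u v w β U)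
    (hP : P.Regular θ L) (hG : P.BoundedSubgradients) (hh : IsProxFunction h)
    {z : DualSpace m p} (hz : z ∈ dualDomain m p) (hzU : ∀ k, z ∈ U k) (k : ℕ) :
    P.dual z - P.dual (u (k + 1)) ≤ (1 - β k) * (P.dual z - P.dual (u k)) +
      β k ^ 2 * (P.lipConst θ L * bregman h z (w k) -
        P.lipConst θ L * bregman h z (w (k + 1))) := by
  set K := P.lipConst θ L
  have hK0 : 0 ≤ K := ConvexProgram.lipConst_nonneg hP.theta_pos
  have hβ := hrun.beta_positive k
  have hv : v k ∈ dualDomain m p := by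
    rw [hrun.v_eq]; exact hrun.combo_mem_dualDomain k (hrun.w_mem_dualDomain k)
  have h1 := hP.neg_dual_le hG (hrun.u_mem (k + 1)) hv
  have h2 := hrun.u_step k
  have e : (1 - β k) • u k + β k • w (k + 1) - v k = β k • (w (k + 1) - w k) := by
    rw [hrun.v_eq]; module
  rw [e, ConvexProgram.linModel_combo, norm_smul, mul_pow, Real.norm_eq_abs, sq_abs] at h2
  have h3 := hP.linModel_le hG (hrun.u_mem k) hv
  have h4 := hP.linModel_le hG hz hv
  have h5 := hh.le_bregman _ (hrun.w_mem_dualDomain (k + 1)) _ (hrun.w_mem_dualDomain k)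
  have h6 := hh.three_point_inequality ((hrun.U_convex k).inter convex_dualDomain)
    Set.inter_subset_right (hrun.w_mem k) ⟨hzU k, hz⟩ (hrun.w_min k)
  change P.linModel (w (k + 1)) (v k) + _ + _ ≤ P.linModel z (v k) + _ at h6
  have h7 := mul_le_mul_of_nonneg_left h3 (sub_nonneg.2 (hrun.beta_le_one k))
  have h8 := mul_le_mul_of_nonneg_left (h6.trans (add_le_add_left h4 _)) hβ.le
  have h9 := mul_le_mul_of_nonneg_left h5 (mul_nonneg hK0 (sq_nonneg (β k)))
  linarith

/-- The `O(1 / k²)` bound for the dual optimality gap. -/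
theorem dual_gap_le (hrun : IsFastGradientRun P (P.lipConst θ L) h u v w β U)
    (hP : P.Regular θ L) (hG : P.BoundedSubgradients) (hh : IsProxFunction h)
    {z : DualSpace m p} (hz : z ∈ P.dualSolutions) (hzU : ∀ k, z ∈ U k) {k : ℕ} (hk : 1 ≤ k) :
    P.dual z - P.dual (u k) ≤
      4 * P.lipConst θ L * bregman h z (w 0) / ((k : ℝ) + 1) ^ 2 := by
  -- β_k controls the gap at u_{k+1}, so β_k ≤ 2/(k + 2) gives the denominator (k + 1) + 1.
  obtain ⟨k, rfl⟩ : ∃ j, k = j + 1 := ⟨k - 1, by omega⟩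
  have hstep := hrun.dual_gap_step hP hG hh hz.1 hzU
  set K := P.lipConst θ L
  have hK0 : 0 ≤ K := ConvexProgram.lipConst_nonneg hP.theta_pos
  have hgap : ∀ j, 0 ≤ P.dual z - P.dual (u j) := fun j => sub_nonneg.2 (hz.2 (hrun.u_mem j))
  have hQ : ∀ j, 0 ≤ K * bregman h z (w j) := fun j =>
    mul_nonneg hK0 (hh.bregman_nonneg hz.1 (hrun.w_mem_dualDomain j))
  have hdiv : ∀ j, (P.dual z - P.dual (u (j + 1))) / β j ^ 2 + K * bregman h z (w (j + 1)) ≤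
      (1 - β j) / β j ^ 2 * (P.dual z - P.dual (u j)) + K * bregman h z (w j) := fun j => by
    have hb : 0 < β j ^ 2 := pow_pos (hrun.beta_positive j) 2
    rw [← sub_nonneg]
    have := div_nonneg (sub_nonneg.2 (hstep j)) hb.le
    rw [sub_div, add_div, mul_div_cancel_left₀ _ hb.ne', mul_div_right_comm] at this
    linarith
  -- The left side is a potential that does not increase, by `beta_step`. Since β_0 = 1, the gap at
  -- u_0 has weight zero and only the Bregman term remains.
  have hsum : ∀ j, (P.dual z - P.dual (u (j + 1))) / β j ^ 2 + K * bregman h z (w (j + 1)) ≤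
      K * bregman h z (w 0) := by
    intro j
    induction j with
    | zero => simpa [hrun.beta_zero] using hdiv 0
    | succ j ih =>
      have h1 := mul_le_mul_of_nonneg_right (hrun.beta_step j) (hgap (j + 1))
      rw [one_div_mul_eq_div] at h1
      linarith [hdiv (j + 1)]
  have hb := hrun.beta_positive k
  have h1 : (P.dual z - P.dual (u (k + 1))) / β k ^ 2 ≤ K * bregman h z (w 0) := by
    linarith [hsum k, hQ (k + 1)]
  rw [div_le_iff₀ (pow_pos hb 2)] at h1
  have h2 : β k ^ 2 ≤ (2 / ((k : ℝ) + 2)) ^ 2 := pow_le_pow_left₀ hb.le (hrun.beta_le_two_div k) 2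
  calc _ ≤ K * bregman h z (w 0) * (2 / ((k : ℝ) + 2)) ^ 2 :=
        h1.trans (mul_le_mul_of_nonneg_left h2 (hQ 0))
    _ = _ := by push_cast; rw [show (k : ℝ) + 1 + 1 = k + 2 by ring, div_pow]; ring

end IsFastGradientRun

/-! ### KKT conditions and recovery of primal estimates. -/

namespace ConvexProgram

variable {n m p : ℕ} {P : ConvexProgram n m p} {θ : ℝ} {L : Fin m → ℝ}

/-- The Karush–Kuhn–Tucker conditions at a dual solution. -/
theorem Regular.kkt_of_mem_dualSolutions (hP : P.Regular θ L) (hG : P.BoundedSubgradients)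
    {z : DualSpace m p} (hz : z ∈ P.dualSolutions) :
    P.xbar z ∈ P.feasible ∧ inner ℝ (P.constraintMap (P.xbar z)) z = 0 := by
  -- First-order optimality of z for d over D; complementarity on the cone then reads as primal
  -- feasibility and complementary slackness.
  have hvar : ∀ u ∈ dualDomain m p, inner ℝ (P.constraintMap (P.xbar z)) (u - z) ≤ 0 := by
    intro u hu
    have hgrad : HasGradientWithinAt (fun y => -P.dual y) (-P.constraintMap (P.xbar z))
        (dualDomain m p) z := by
      have h1 := (hP.hasGradientWithinAt_dual hG hz.1).hasFDerivWithinAt.neg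
      rw [hasGradientWithinAt_iff_hasFDerivWithinAt, map_neg]
      exact h1
    have h2 := IsMinOn.inner_gradient_nonneg convex_dualDomain
      hz.2.neg hgrad hz.1 hu
    rw [inner_neg_left] at h2
    linarith
  obtain ⟨h0, h1, h2⟩ := complementarity_of_variational_inequality hz.1 hvar
  exact ⟨⟨(hP.xbar_spec hz.1).1, h1, by ext j; exact h2 j⟩, h0⟩

theorem inner_constraintMap_nonpos {x : EuclideanSpace ℝ (Fin n)} (hx : x ∈ P.feasible)
    {u : DualSpace m p} (hu : u ∈ dualDomain m p) : inner ℝ (P.constraintMap x) u ≤ 0 := by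
  simp only [PiLp.inner_apply, Fintype.sum_sum_type, constraintMap_inl, constraintMap_inr,
    hx.2.2, PiLp.zero_apply, inner_zero_left, Finset.sum_const_zero, add_zero]
  exact Finset.sum_nonpos fun i _ => by
    simpa using mul_nonpos_of_nonneg_of_nonpos (hu i) (hx.2.1 i)

/-- Weak duality with the growth term kept, so that a small dual gap forces x̄(u) close to the
solution. -/
theorem Regular.dual_add_le_of_feasible (hP : P.Regular θ L) {u : DualSpace m p}
    (hu : u ∈ dualDomain m p) {x : EuclideanSpace ℝ (Fin n)} (hx : x ∈ P.feasible) :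
    P.dual u + θ / 2 * ‖x - P.xbar u‖ ^ 2 ≤ P.f x := by
  have h1 := hP.dual_add_le_lagrangian hu hx.1
  rw [lagrangian_eq] at h1
  linarith [inner_constraintMap_nonpos hx hu]

/-- The infeasibility is bounded by the distance of the constraint values to those of a feasible
point. -/
theorem infeasibility_le {x y : EuclideanSpace ℝ (Fin n)} (hy : y ∈ P.feasible) :
    P.infeasibility x ≤ ‖P.constraintMap x - P.constraintMap y‖ := by
  have hle : ‖P.eqResidual x‖ ^ 2 + ∑ i, (max 0 (P.g i x)) ^ 2 ≤
      ‖P.constraintMap x - P.constraintMap y‖ ^ 2 := by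
    rw [norm_constraintMap_sub_sq, hy.2.2, sub_zero, add_comm]
    gcongr ?_ + _
    refine Finset.sum_le_sum fun i _ => ?_
    rcases le_total (P.g i x) 0 with h | h
    · rw [max_eq_left h]
      nlinarith [sq_nonneg (P.g i x - P.g i y)]
    · rw [max_eq_right h]
      exact pow_le_pow_left₀ h (by linarith [hy.2.1 i]) 2
  exact Real.sqrt_le_iff.2 ⟨norm_nonneg _, hle⟩

end ConvexProgram

namespace ConvexProgram

variable {n m p : ℕ} {P : ConvexProgram n m p} {θ : ℝ} {L : Fin m → ℝ}

/-- Strong duality: complementary slackness removes the constraint terms of the Lagrangian. -/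
theorem Regular.f_xbar_eq_dual (hP : P.Regular θ L) (hG : P.BoundedSubgradients)
    {z : DualSpace m p} (hz : z ∈ P.dualSolutions) : P.f (P.xbar z) = P.dual z := by
  rw [hP.dual_eq hz.1, lagrangian_eq, (hP.kkt_of_mem_dualSolutions hG hz).2, add_zero]

theorem Regular.isPrimalSolution_xbar (hP : P.Regular θ L) (hG : P.BoundedSubgradients)
    {z : DualSpace m p} (hz : z ∈ P.dualSolutions) :
    P.IsPrimalSolution (P.xbar z) ∧ ∀ x, P.IsPrimalSolution x → x = P.xbar z := by
  have hθ := hP.theta_pos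
  have hfeas := (hP.kkt_of_mem_dualSolutions hG hz).1
  refine ⟨⟨hfeas, fun y hy => ?_⟩, fun x hx => hP.eq_xbar hz.1 hx.1.1 ?_⟩
  · have h1 := hP.dual_add_le_of_feasible hz.1 hy
    rw [← hP.f_xbar_eq_dual hG hz] at h1
    have h2 : 0 ≤ θ / 2 * ‖y - P.xbar z‖ ^ 2 := by positivity
    exact (le_add_of_nonneg_right h2).trans h1
  -- Any solution x satisfies ℒ(x, z) ≤ f(x) ≤ d(z), hence minimizes ℒ(·, z).
  · have h1 : P.f x ≤ P.f (P.xbar z) := hx.2 hfeas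
    rw [← hP.dual_eq hz.1, ← hP.f_xbar_eq_dual hG hz, lagrangian_eq]
    linarith [inner_constraintMap_nonpos hx.1 hz.1]

theorem Regular.primalValue_eq (hP : P.Regular θ L) (hG : P.BoundedSubgradients)
    {z : DualSpace m p} (hz : z ∈ P.dualSolutions) : P.primalValue = P.f (P.xbar z) := by
  have hsol := (hP.isPrimalSolution_xbar hG hz).1
  exact IsLeast.csInf_eq ⟨⟨_, hsol.1, rfl⟩, by rintro _ ⟨y, hy, rfl⟩; exact hsol.2 hy⟩

theorem dualValue_eq {z : DualSpace m p} (hz : z ∈ P.dualSolutions) :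
    P.dualValue = P.dual z :=
  IsGreatest.csSup_eq ⟨⟨_, hz.1, rfl⟩, by rintro _ ⟨y, hy, rfl⟩; exact hz.2 hy⟩

/-- Distance of the constraint values at `x̄(u)` to those at the solution, in terms of a bound for
the dual optimality gap. -/
theorem Regular.norm_constraintMap_xbar_sub_le_of_gap (hP : P.Regular θ L)
    (hG : P.BoundedSubgradients) {u z : DualSpace m p} (hu : u ∈ dualDomain m p)
    (hz : z ∈ P.dualSolutions) {q r : ℝ} (hq : 0 ≤ q) (hr : 0 < r)
    (hgap : P.dual z - P.dual u ≤ 4 * P.lipConst θ L * q / r ^ 2) :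
    ‖P.xbar u - P.xbar z‖ ≤ Real.sqrt (8 * P.lipConst θ L * q * θ⁻¹) / r ∧
      ‖P.constraintMap (P.xbar u) - P.constraintMap (P.xbar z)‖ ≤
        P.lipConst θ L * Real.sqrt (8 * q) / r := by
  have hθ := hP.theta_pos
  have hK : 0 ≤ P.lipConst θ L := lipConst_nonneg hθ
  have h1 := hP.dual_add_le_of_feasible hu (hP.kkt_of_mem_dualSolutions hG hz).1
  rw [hP.f_xbar_eq_dual hG hz, norm_sub_rev] at h1
  have h2 := hP.norm_constraintMap_xbar_sub_sq_le hG hu hz.1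
  set K := P.lipConst θ L
  -- The 8 is the 4 of the gap bound times the 2 from θ/2.
  have h3 : θ * ‖P.xbar u - P.xbar z‖ ^ 2 ≤ 8 * K * q / r ^ 2 := by
    have : 8 * K * q / r ^ 2 = 2 * (4 * K * q / r ^ 2) := by ring
    linarith
  constructor
  · refine abs_le_of_sq_le_sq' ?_ (by positivity) |>.2
    rw [div_pow, Real.sq_sqrt (by positivity)]
    refine le_of_mul_le_mul_left (h3.trans_eq ?_) hθ
    field_simp
  · refine abs_le_of_sq_le_sq' ?_ (by positivity) |>.2
    rw [div_pow, mul_pow, Real.sq_sqrt (by positivity)]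
    calc _ ≤ K * (θ * ‖P.xbar u - P.xbar z‖ ^ 2) := by linarith
      _ ≤ K * (8 * K * q / r ^ 2) := mul_le_mul_of_nonneg_left h3 hK
      _ = _ := by ring

/-- Here f(x̄(u)) = d(u) - ⟨c(x̄(u)), u⟩. Replacing c(x̄(u)) by c(x̄(z)) costs the Hölder term, and
the supergradient at z with complementary slackness gives -⟨c(x̄(z)), u⟩ ≤ d(z) - d(u). The gap
cancels in the sum; its nonnegativity `h4` puts it back. -/
theorem Regular.f_xbar_sub_le (hP : P.Regular θ L) (hG : P.BoundedSubgradients)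
    {u z : DualSpace m p} (hu : u ∈ dualDomain m p) (hz : z ∈ P.dualSolutions) :
    P.f (P.xbar u) - P.primalValue ≤ (⨆ i, |u i|) * (Real.sqrt ((m : ℝ) + p) *
      ‖P.constraintMap (P.xbar u) - P.constraintMap (P.xbar z)‖) + (P.dual z - P.dual u) := by
  have hθ := hP.theta_pos
  have h1 := hP.dual_eq hu
  rw [lagrangian_eq] at h1
  have h2 := hP.dual_le hu hz.1
  have h3 : 0 ≤ θ / 2 * ‖P.xbar u - P.xbar z‖ ^ 2 := by positivity
  have h4 : P.dual u ≤ P.dual z := hz.2 hu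
  have h5 := (abs_le.1 (abs_inner_le_iSup_abs_mul_norm u
    (P.constraintMap (P.xbar u) - P.constraintMap (P.xbar z)))).1
  rw [inner_sub_right, real_inner_comm, real_inner_comm (P.constraintMap (P.xbar z)) u] at h5
  rw [inner_sub_right, (hP.kkt_of_mem_dualSolutions hG hz).2] at h2
  rw [hP.primalValue_eq hG hz, hP.f_xbar_eq_dual hG hz]
  linarith

/-- From ℒ(x̄(u), z) ≥ d(z) = f⋆; complementary slackness allows c(x̄(z)) to be subtracted before
Cauchy–Schwarz. -/
theorem Regular.neg_le_f_xbar_sub (hP : P.Regular θ L) (hG : P.BoundedSubgradients)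
    {u z : DualSpace m p} (hu : u ∈ dualDomain m p) (hz : z ∈ P.dualSolutions) :
    -(‖z‖ * ‖P.constraintMap (P.xbar u) - P.constraintMap (P.xbar z)‖) ≤
      P.f (P.xbar u) - P.primalValue := by
  have hθ := hP.theta_pos
  have h1 := hP.dual_add_le_lagrangian hz.1 (hP.xbar_spec hu).1
  rw [lagrangian_eq] at h1
  have h3 : 0 ≤ θ / 2 * ‖P.xbar u - P.xbar z‖ ^ 2 := by positivity
  have h5 := (abs_le.1 (abs_real_inner_le_norm
    (P.constraintMap (P.xbar u) - P.constraintMap (P.xbar z)) z)).2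
  rw [inner_sub_left, (hP.kkt_of_mem_dualSolutions hG hz).2] at h5
  rw [hP.primalValue_eq hG hz, hP.f_xbar_eq_dual hG hz]
  linarith

end ConvexProgram

/-! ### The main theorem. -/

theorem mainTheorem3 {n m p : ℕ} (P : ConvexProgram n m p) (θ : ℝ) (L : Fin m → ℝ)
    (hP : P.Regular θ L) (hG : P.BoundedSubgradients)
    (h : DualSpace m p → ℝ) (hh : IsProxFunction h)
    (u v w : ℕ → DualSpace m p) (β : ℕ → ℝ) (U : ℕ → Set (DualSpace m p))
    (hrun : IsFastGradientRun P (P.lipConst θ L) h u v w β U)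
    (uStar : DualSpace m p) (huStar : uStar ∈ P.dualSolutions) (huU : ∀ k, uStar ∈ U k) :
    -- the objects in the bounds are well defined
    (∀ z ∈ dualDomain m p,
      P.IsLagrangianMinimizer z (P.xbar z) ∧
      (∀ x, P.IsLagrangianMinimizer z x → x = P.xbar z) ∧
      DifferentiableWithinAt ℝ P.dual (dualDomain m p) z) ∧
    BddAbove (P.gamma θ '' dualDomain m p) ∧
    ∃ xStar, P.IsPrimalSolution xStar ∧ (∀ x, P.IsPrimalSolution x → x = xStar) ∧
      -- the bounds
      ∀ k : ℕ, 1 ≤ k →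
        P.dualValue - P.dual (u k) ≤
          4 * P.lipConst θ L * bregman h uStar (w 0) / ((k : ℝ) + 1) ^ 2 ∧
        ‖P.xbar (u k) - xStar‖ ≤
          Real.sqrt (8 * P.lipConst θ L * bregman h uStar (w 0) * θ⁻¹) / ((k : ℝ) + 1) ∧
        P.f (P.xbar (u k)) - P.primalValue ≤
          P.lipConst θ L * (⨆ i, |u k i|) *
              Real.sqrt (8 * ((m : ℝ) + p) * bregman h uStar (w 0)) / ((k : ℝ) + 1) +
            4 * P.lipConst θ L * bregman h uStar (w 0) / ((k : ℝ) + 1) ^ 2 ∧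
        -(P.lipConst θ L * ‖uStar‖ * Real.sqrt (8 * bregman h uStar (w 0)) / ((k : ℝ) + 1)) ≤
          P.f (P.xbar (u k)) - P.primalValue ∧
        P.infeasibility (P.xbar (u k)) ≤
          P.lipConst θ L * Real.sqrt (8 * bregman h uStar (w 0)) / ((k : ℝ) + 1) := by
  refine ⟨fun z hz => ⟨hP.isLagrangianMinimizer_xbar hz, fun x hx => hP.eq_xbar hz hx.1
    (hx.2 (hP.xbar_spec hz).1), (hP.hasGradientWithinAt_dual hG hz).differentiableWithinAt⟩,
    hG.bddAbove_gamma hP.theta_pos, P.xbar uStar, (hP.isPrimalSolution_xbar hG huStar).1,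
    (hP.isPrimalSolution_xbar hG huStar).2, fun k hk => ?_⟩
  have hgap := hrun.dual_gap_le hP hG hh huStar huU hk
  have hq : 0 ≤ bregman h uStar (w 0) := hh.bregman_nonneg huStar.1 hrun.w_zero_mem
  have hr : (0 : ℝ) < (k : ℝ) + 1 := by positivity
  obtain ⟨hx, hc⟩ := hP.norm_constraintMap_xbar_sub_le_of_gap hG (hrun.u_mem k) huStar hq hr hgap
  refine ⟨by rwa [ConvexProgram.dualValue_eq huStar], hx, ?_, ?_, ?_⟩
  · refine (hP.f_xbar_sub_le hG (hrun.u_mem k) huStar).trans (add_le_add ?_ hgap)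
    calc _ ≤ (⨆ i, |u k i|) * (Real.sqrt ((m : ℝ) + p) *
          (P.lipConst θ L * Real.sqrt (8 * bregman h uStar (w 0)) / ((k : ℝ) + 1))) :=
        mul_le_mul_of_nonneg_left (mul_le_mul_of_nonneg_left hc (Real.sqrt_nonneg _))
          (Real.iSup_nonneg fun i => abs_nonneg _)
      _ = _ := by
        rw [show 8 * ((m : ℝ) + p) * bregman h uStar (w 0) =
          ((m : ℝ) + p) * (8 * bregman h uStar (w 0)) by ring,
          Real.sqrt_mul (by positivity : (0 : ℝ) ≤ (m : ℝ) + p)]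
        ring
  · refine le_trans (neg_le_neg ?_) (hP.neg_le_f_xbar_sub hG (hrun.u_mem k) huStar)
    refine (mul_le_mul_of_nonneg_left hc (norm_nonneg _)).trans_eq ?_
    ring
  · exact (ConvexProgram.infeasibility_le
      (hP.kkt_of_mem_dualSolutions hG huStar).1).trans hc
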